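/- Let $G$ be a compact Lie group, let $\varsigma\colon G\to O(n)$ be a continuous homomorphism, and let $G$ act on $\mathbb{R}^n$ by $gv=\varsigma(g)v$; write $G(v)=\{gv: g\in G\}$ for the orbit of $v$. Let $\Omega\subset\mathbb{R}^n$ be open and $G$-invariant, and let $\varphi\colon\Omega\times\mathbb{R}\to\mathbb{R}$ be of class $C^2$ with $\varphi(gv,\rho)=\varphi(v,\rho)$ for all $g\in G$, $v\in\Omega$, $\rho\in\mathbb{R}$. Let $w\colon\mathbb{R}\to\Omega$ be a continuous map such that $$\mathcal{F}=\bigcup_{\rho\in\mathbb{R}}G(w(\rho))\times\{\rho\}\subset\{(v,\rho)\in\Omega\times\mathbb{R}:\nabla_v\varphi(v,\rho)=0\}.$$ A number $\rho_0\in\mathbb{R}$ is called a parameter of local bifurcation if $(w(\rho_0),\rho_0)$ is an accumulation point of the set $\{(v,\rho)\in(\Omega\times\mathbb{R})\setminus\mathcal{F}:\nabla_v\varphi(v,\rho)=0\}$ of nontrivial solutions. If $\rho_0$ is a parameter of local bifurcation, then $$\dim\ker\nabla_v^2\varphi(w(\rho_0),\rho_0)>\dim G(w(\rho_0)),$$ where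 $\nabla_v^2\varphi$ is the Hessian of $\varphi$ with respect to $v$ and $\dim G(w(\rho_0))$ is the dimension of the orbit as a submanifold of $\mathbb{R}^n$ (the dimension of its tangent space). -/

import Mathlib

open scoped ContDiff Manifold

noncomputable section

namespace EquivariantBifurcation

/-- The Euclidean space `ℝⁿ`. -/
abbrev Eucl (n : ℕ) : Type := EuclideanSpace ℝ (Fin n)

variable {G : Type*} [Group G] {n : ℕ}

/-- The linear action `g v = ς(g) v` of `G` on `ℝⁿ` given by a homomorphism `ς : G → O(n)`. -/
def act (ς : G →* Matrix.orthogonalGroup (Fin n) ℝ) (g : G) (v : Eucl n) : Eucl n :=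
  Matrix.toEuclideanLin (ς g : Matrix (Fin n) (Fin n) ℝ) v

/-- The orbit `G(v) = {g v : g ∈ G}`. -/
def orbit (ς : G →* Matrix.orthogonalGroup (Fin n) ℝ) (v : Eucl n) : Set (Eucl n) :=
  Set.range fun g : G => act ς g v

/-- `Ω` is a `G`-invariant subset of `ℝⁿ`. -/
def IsInvariantSet (ς : G →* Matrix.orthogonalGroup (Fin n) ℝ) (Ω : Set (Eucl n)) : Prop :=
  ∀ g : G, ∀ v ∈ Ω, act ς g v ∈ Ω

/-- `φ : Ω × ℝ → ℝ` is `G`-invariant (`G` acts trivially on the parameter). -/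
def IsInvariantFun (ς : G →* Matrix.orthogonalGroup (Fin n) ℝ) (Ω : Set (Eucl n))
    (φ : Eucl n → ℝ → ℝ) : Prop :=
  ∀ g : G, ∀ v ∈ Ω, ∀ ρ : ℝ, φ (act ς g v) ρ = φ v ρ

/-- The tangent space at `v` of a submanifold `S ⊆ ℝⁿ` with `v ∈ S`: the space of the velocities
`γ'(0)` of the `C¹` curves `γ` that lie in `S` near time `0` and satisfy `γ(0) = v`.
(For a submanifold the velocities already form a linear subspace.) -/
def tangentSpaceOf (S : Set (Eucl n)) (v : Eucl n) : Submodule ℝ (Eucl n) :=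
  Submodule.span ℝ {u | ∃ γ : ℝ → Eucl n, ContDiffAt ℝ 1 γ 0 ∧ γ 0 = v ∧
    (∀ᶠ t in nhds (0 : ℝ), γ t ∈ S) ∧ HasDerivAt γ u 0}

/-- The dimension of the orbit `G(v)`, that is the dimension of its tangent space `T_v G(v)`.
(The orbit is a homogeneous submanifold, so this does not depend on the point.) -/
def orbitDim (ς : G →* Matrix.orthogonalGroup (Fin n) ℝ) (v : Eucl n) : ℕ :=
  Module.finrank ℝ (tangentSpaceOf (orbit ς v) v)

/-- The gradient `∇_v φ(v, ρ)` with respect to the first variable. -/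
def gradV (φ : Eucl n → ℝ → ℝ) (v : Eucl n) (ρ : ℝ) : Eucl n :=
  gradient (fun u => φ u ρ) v

/-- The Hessian `∇_v² φ(v, ρ)` with respect to the first variable, as a linear operator. -/
def hessV (φ : Eucl n → ℝ → ℝ) (v : Eucl n) (ρ : ℝ) : Eucl n →L[ℝ] Eucl n :=
  fderiv ℝ (fun u => gradV φ u ρ) v

/-- The set `(∇_v φ)⁻¹(0) ⊆ Ω × ℝ`. -/
def criticalSet (Ω : Set (Eucl n)) (φ : Eucl n → ℝ → ℝ) : Set (Eucl n × ℝ) :=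
  {p | p.1 ∈ Ω ∧ gradV φ p.1 p.2 = 0}

/-- The family `𝓕 = ⋃_ρ G(w(ρ)) × {ρ}`. -/
def trivialFamily (ς : G →* Matrix.orthogonalGroup (Fin n) ℝ) (w : ℝ → Eucl n) :
    Set (Eucl n × ℝ) :=
  ⋃ ρ : ℝ, orbit ς (w ρ) ×ˢ {ρ}

/-- The set of parameters of local bifurcation: those `ρ₀` for which `(w(ρ₀), ρ₀)` is an
accumulation point of the set of nontrivial solutions of `∇_v φ(v, ρ) = 0` in `Ω × ℝ`. -/
def BIF (ς : G →* Matrix.orthogonalGroup (Fin n) ℝ) (Ω : Set (Eucl n))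
    (φ : Eucl n → ℝ → ℝ) (w : ℝ → Eucl n) : Set ℝ :=
  {ρ₀ | AccPt (w ρ₀, ρ₀) (Filter.principal (criticalSet Ω φ \ trivialFamily ς w))}

end EquivariantBifurcation

end

open EquivariantBifurcation

namespace EquivariantBifurcation

open Filter Topology

section Action

variable {G : Type*} [Group G] {n : ℕ} (ς : G →* Matrix.orthogonalGroup (Fin n) ℝ)

/-! Put `v₀ = w ρ₀`, let `T` be the tangent space of its orbit and `N = Tᗮ`. The orbit consists of
critical points, so `T` lies in the kernel of the Hessian. If the strict inequality fails, the two
are equal and the Hessian is injective on `N`; strict differentiability of the gradient then makes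
`gradV φ · ρ` injective along translates of `N`, uniformly near `(v₀, ρ₀)`
(`exists_ball_injOn_of_hasStrictFDerivAt`). A point of the orbit of `v` nearest to `v₀` lies in `v₀
+ N` (`exists_act_sub_mem_orthogonal`). Moving a nearby critical point `v` and `w ρ` there gives two
zeros of the gradient differing by an element of `N`. They coincide, so `v` is on the orbit of `w ρ`
and is trivial. -/

theorem act_mul (g h : G) (v : Eucl n) : act ς (g * h) v = act ς g (act ς h v) := by
  simp [act, Matrix.toLpLin_apply]

theorem act_one (v : Eucl n) : act ς 1 v = v := by
  simp [act]

theorem act_sub (g : G) (u v : Eucl n) : act ς g (u - v) = act ς g u - act ς g v :=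
  map_sub _ u v

theorem norm_act (g : G) (v : Eucl n) : ‖act ς g v‖ = ‖v‖ := by
  have h := (Matrix.mem_orthogonalGroup_iff' (Fin n) ℝ).1 (ς g).2
  have key : inner ℝ (act ς g v) (act ς g v) = inner ℝ v v := by
    simp only [act, Matrix.toLpLin_apply, EuclideanSpace.inner_eq_star_dotProduct, star_trivial]
    rw [Matrix.dotProduct_mulVec, ← Matrix.mulVec_transpose, Matrix.mulVec_mulVec]
    rw [h, Matrix.one_mulVec]
  rw [real_inner_self_eq_norm_sq, real_inner_self_eq_norm_sq] at key
  exact (sq_eq_sq₀ (norm_nonneg _) (norm_nonneg _)).1 key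

theorem continuous_act_left [TopologicalSpace G] (hς : Continuous ς) (v : Eucl n) :
    Continuous fun g => act ς g v := by
  simp only [act, Matrix.toLpLin_apply]
  exact (PiLp.continuous_toLp 2 _).comp
    ((continuous_subtype_val.comp hς).matrix_mulVec continuous_const)

/-- If `v` is a nearest point to `x` in `S`, then `x - v` is normal to `S` at `v`. -/
theorem sub_mem_orthogonal_tangentSpaceOf {S : Set (Eucl n)} {v x : Eucl n}
    (h : ∀ y ∈ S, ‖x - v‖ ≤ ‖x - y‖) : x - v ∈ (tangentSpaceOf S v)ᗮ := by
  rw [Submodule.mem_orthogonal]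
  intro u hu
  refine Submodule.span_induction ?_ ?_ ?_ ?_ hu
  · rintro u ⟨γ, -, h0, hS, hd⟩
    -- The square keeps the distance differentiable even when `x = v`.
    have hmin : IsLocalMin (fun t => ‖x - γ t‖ ^ 2) 0 := by
      filter_upwards [hS] with t ht
      simp only [h0]
      gcongr
      exact h _ ht
    have := hmin.hasDerivAt_eq_zero (hd.const_sub x).norm_sq
    rw [h0, inner_neg_right, real_inner_comm] at this
    linarith
  · simp
  · intro a b _ _ ha hb
    rw [inner_add_left, ha, hb, add_zero]
  · intro c a _ ha
    rw [inner_smul_left, ha, mul_zero]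

/-- Every vector can be moved by the group into the affine normal space of the orbit of `v₀`. -/
theorem exists_act_sub_mem_orthogonal [TopologicalSpace G] [CompactSpace G] (hς : Continuous ς)
    (v₀ v : Eucl n) :
    ∃ g, act ς g v - v₀ ∈ (tangentSpaceOf (orbit ς v₀) v₀)ᗮ ∧ ‖act ς g v - v₀‖ ≤ ‖v - v₀‖ := by
  obtain ⟨g, -, hg⟩ := isCompact_univ.exists_isMinOn (Set.univ_nonempty (α := G))
    (((continuous_act_left ς hς v).sub continuous_const).norm (f := fun g => act ς g v - v₀)
      |>.continuousOn)
  have hmin : ∀ h, ‖act ς g v - v₀‖ ≤ ‖act ς h v - v₀‖ := fun h => hg (Set.mem_univ h)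
  refine ⟨g, sub_mem_orthogonal_tangentSpaceOf ?_, ?_⟩
  · rintro _ ⟨h, rfl⟩
    -- Since the action is isometric, minimality of `g v` in its orbit makes `v₀` a nearest point to
    -- `g v` in the orbit of `v₀`.
    calc ‖act ς g v - v₀‖ ≤ ‖act ς (h⁻¹ * g) v - v₀‖ := hmin _
      _ = ‖act ς h (act ς (h⁻¹ * g) v - v₀)‖ := (norm_act ς h _).symm
      _ = ‖act ς g v - act ς h v₀‖ := by rw [act_sub, ← act_mul, mul_inv_cancel_left]
  · simpa [act_one] using hmin 1

end Action

section Gradient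

variable {n : ℕ} {Ω : Set (Eucl n)} {φ : Eucl n → ℝ → ℝ}

theorem differentiableAt_of_contDiffOn (hΩ : IsOpen Ω)
    (hφ : ContDiffOn ℝ 2 (fun p : Eucl n × ℝ => φ p.1 p.2) (Ω ×ˢ Set.univ))
    {v : Eucl n} (hv : v ∈ Ω) (ρ : ℝ) :
    DifferentiableAt ℝ (fun p : Eucl n × ℝ => φ p.1 p.2) (v, ρ) :=
  (hφ.contDiffAt ((hΩ.prod isOpen_univ).mem_nhds ⟨hv, Set.mem_univ _⟩)).differentiableAt
    (by norm_num)

theorem hasFDerivAt_slice (hΩ : IsOpen Ω)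
    (hφ : ContDiffOn ℝ 2 (fun p : Eucl n × ℝ => φ p.1 p.2) (Ω ×ˢ Set.univ))
    {v : Eucl n} (hv : v ∈ Ω) (ρ : ℝ) :
    HasFDerivAt (fun u => φ u ρ) ((fderiv ℝ (fun p : Eucl n × ℝ => φ p.1 p.2) (v, ρ)).comp
      (ContinuousLinearMap.inl ℝ (Eucl n) ℝ)) v :=
  (differentiableAt_of_contDiffOn hΩ hφ hv ρ).hasFDerivAt.comp v
    (f := fun u : Eucl n => (u, ρ)) (hasFDerivAt_prodMk_left v ρ)

/-- The gradient in the first variable is of class `C¹` jointly in both variables. -/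
theorem contDiffAt_gradV (hΩ : IsOpen Ω)
    (hφ : ContDiffOn ℝ 2 (fun p : Eucl n × ℝ => φ p.1 p.2) (Ω ×ˢ Set.univ))
    {v : Eucl n} (hv : v ∈ Ω) (ρ : ℝ) :
    ContDiffAt ℝ 1 (fun p : Eucl n × ℝ => gradV φ p.1 p.2) (v, ρ) := by
  have hmem : Ω ×ˢ (Set.univ : Set ℝ) ∈ 𝓝 (v, ρ) :=
    (hΩ.prod isOpen_univ).mem_nhds ⟨hv, Set.mem_univ _⟩
  have h1 : ContDiffAt ℝ 1 (fderiv ℝ (fun p : Eucl n × ℝ => φ p.1 p.2)) (v, ρ) :=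
    (hφ.contDiffAt hmem).fderiv_right (by norm_num)
  have h2 := (InnerProductSpace.toDual ℝ (Eucl n)).symm.contDiff.contDiffAt.comp (v, ρ)
    (h1.clm_comp (contDiffAt_const (c := ContinuousLinearMap.inl ℝ (Eucl n) ℝ)))
  refine h2.congr_of_eventuallyEq ?_
  filter_upwards [hmem] with p hp
  simp only [gradV, gradient, Function.comp]
  rw [(hasFDerivAt_slice hΩ hφ hp.1 p.2).fderiv]

theorem gradV_eq_zero_iff {v : Eucl n} {ρ : ℝ} :
    gradV φ v ρ = 0 ↔ fderiv ℝ (fun u => φ u ρ) v = 0 := by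
  simp [gradV, gradient]

/-- Critical points of an invariant function form an invariant set. -/
theorem gradV_act_eq_zero {G : Type*} [Group G] {ς : G →* Matrix.orthogonalGroup (Fin n) ℝ}
    (hΩ : IsOpen Ω) (hΩG : IsInvariantSet ς Ω)
    (hφ : ContDiffOn ℝ 2 (fun p : Eucl n × ℝ => φ p.1 p.2) (Ω ×ˢ Set.univ))
    (hφG : IsInvariantFun ς Ω φ) {v : Eucl n} (hv : v ∈ Ω) {ρ : ℝ} (h : gradV φ v ρ = 0) (g : G) :
    gradV φ (act ς g v) ρ = 0 := by
  rw [gradV_eq_zero_iff] at h ⊢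
  have hd := (hasFDerivAt_slice hΩ hφ hv ρ).differentiableAt.hasFDerivAt
  rw [h] at hd
  have hinv : act ς g⁻¹ (act ς g v) = v := by rw [← act_mul, inv_mul_cancel, act_one]
  have hL : HasFDerivAt (act ς g⁻¹)
      (Matrix.toEuclideanLin (ς g⁻¹ : Matrix (Fin n) (Fin n) ℝ)).toContinuousLinearMap
      (act ς g v) := ContinuousLinearMap.hasFDerivAt (LinearMap.toContinuousLinearMap _)
  rw [← hinv] at hd
  -- Near `g v`, `φ` equals its composite with `g⁻¹`, so the chain rule carries the vanishing
  -- derivative from `v` to `g v`.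
  have hc := hd.comp (act ς g v) hL
  rw [ContinuousLinearMap.zero_comp] at hc
  refine (hc.congr_of_eventuallyEq ?_).fderiv
  filter_upwards [hΩ.mem_nhds (hΩG g v hv)] with u hu
  exact (hφG g⁻¹ u hu ρ).symm

/-- Tangent vectors of a set of critical points lie in the kernel of the Hessian. -/
theorem tangentSpaceOf_le_ker_hessV {S : Set (Eucl n)} {v : Eucl n} {ρ : ℝ}
    (hd : DifferentiableAt ℝ (fun u => gradV φ u ρ) v) (hS : ∀ u ∈ S, gradV φ u ρ = 0) :
    tangentSpaceOf S v ≤ LinearMap.ker (hessV φ v ρ).toLinearMap := by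
  refine Submodule.span_le.2 ?_
  rintro u ⟨γ, -, rfl, hγ, hu⟩
  have h1 : HasDerivAt (fun t => gradV φ (γ t) ρ) (hessV φ (γ 0) ρ u) 0 :=
    hd.hasFDerivAt.comp_hasDerivAt 0 hu
  have h2 : HasDerivAt (fun t => gradV φ (γ t) ρ) 0 0 :=
    (hasDerivAt_const 0 (0 : Eucl n)).congr_of_eventuallyEq <| by
      filter_upwards [hγ] with t ht using hS _ ht
  exact h1.unique h2

end Gradient

/-- If a parameter-dependent map `f` is strictly differentiable and its partial derivative is
injective on a subspace `N`, then each `f (·, ρ)` is injective on translates of `N`, locally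
uniformly in `ρ`. -/
theorem exists_ball_injOn_of_hasStrictFDerivAt {V W : Type*}
    [NormedAddCommGroup V] [NormedSpace ℝ V] [FiniteDimensional ℝ V]
    [NormedAddCommGroup W] [NormedSpace ℝ W] {f : V × ℝ → W} {L : V × ℝ →L[ℝ] W} {v₀ : V}
    {ρ₀ : ℝ} (hf : HasStrictFDerivAt f L (v₀, ρ₀)) {N : Submodule ℝ V}
    (hN : ∀ u ∈ N, L (u, 0) = 0 → u = 0) :
    ∃ δ > 0, ∀ x y : V, ∀ ρ : ℝ, ‖x - v₀‖ < δ → ‖y - v₀‖ < δ → |ρ - ρ₀| < δ →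
      x - y ∈ N → f (x, ρ) = f (y, ρ) → x = y := by
  let A : N →ₗ[ℝ] W := (L.toLinearMap ∘ₗ LinearMap.inl ℝ V ℝ) ∘ₗ N.subtype
  have hA : LinearMap.ker A = ⊥ := by
    refine LinearMap.ker_eq_bot'.2 fun u hu => Subtype.ext (hN u u.2 hu)
  obtain ⟨K, hK, hAK⟩ := A.exists_antilipschitzWith hA
  have hKpos : (0 : ℝ) < K := hK
  -- `L` is bounded below by `1 / K` on `N`; an error of half that size forces `‖x - y‖ ≤ ‖x - y‖ /
  -- 2`.
  have hlo := hf.isLittleO.def (c := (2 * K : ℝ)⁻¹) (by positivity)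
  obtain ⟨δ, hδ, hball⟩ := Metric.eventually_nhds_iff.1 hlo
  refine ⟨δ, hδ, fun x y ρ hx hy hρ hxy hfxy => ?_⟩
  have hb := @hball ((x, ρ), (y, ρ)) (by
    simp only [dist_eq_norm]
    simp [hx, hy, hρ])
  simp only [hfxy, sub_self, zero_sub, norm_neg, Prod.mk_sub_mk] at hb
  have hnorm : ‖((x - y, 0) : V × ℝ)‖ = ‖x - y‖ := by simp [Prod.norm_def]
  rw [hnorm] at hb
  have hlow : ‖x - y‖ ≤ K * ‖L (x - y, 0)‖ := by
    have h := hAK.le_mul_dist ⟨x - y, hxy⟩ 0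
    rw [map_zero, dist_zero_right, dist_zero_right] at h
    exact h
  have : K * ‖L (x - y, 0)‖ ≤ 2⁻¹ * ‖x - y‖ := by
    calc K * ‖L (x - y, 0)‖ ≤ K * ((2 * K : ℝ)⁻¹ * ‖x - y‖) := by gcongr
      _ = 2⁻¹ * ‖x - y‖ := by field_simp
  have h0 : ‖x - y‖ = 0 := by linarith [norm_nonneg (x - y)]
  exact sub_eq_zero.1 (norm_eq_zero.1 h0)

end EquivariantBifurcation

theorem mainTheorem3
    {E : Type*} [NormedAddCommGroup E] [NormedSpace ℝ E] [FiniteDimensional ℝ E]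
    {H : Type*} [TopologicalSpace H] (I : ModelWithCorners ℝ E H) [I.Boundaryless]
    {G : Type*} [Group G] [TopologicalSpace G] [ChartedSpace H G] [LieGroup I ∞ G]
    [T2Space G] [CompactSpace G]
    {n : ℕ} (ς : G →* Matrix.orthogonalGroup (Fin n) ℝ) (hς : Continuous ς)
    (Ω : Set (Eucl n)) (hΩ : IsOpen Ω) (hΩG : IsInvariantSet ς Ω)
    (φ : Eucl n → ℝ → ℝ)
    (hφ : ContDiffOn ℝ 2 (fun p : Eucl n × ℝ => φ p.1 p.2) (Ω ×ˢ Set.univ))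
    (hφG : IsInvariantFun ς Ω φ)
    (w : ℝ → Eucl n) (hw : Continuous w) (hwΩ : ∀ ρ : ℝ, w ρ ∈ Ω)
    (hF : trivialFamily ς w ⊆ criticalSet Ω φ)
    (ρ₀ : ℝ) (hρ₀ : ρ₀ ∈ BIF ς Ω φ w) :
    orbitDim ς (w ρ₀) < Module.finrank ℝ (LinearMap.ker (hessV φ (w ρ₀) ρ₀).toLinearMap) := by

  have hv₀ := hwΩ ρ₀
  have hC1 := contDiffAt_gradV hΩ hφ hv₀ ρ₀
  have hstrict := hC1.hasStrictFDerivAt one_ne_zero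
  set L := fderiv ℝ (fun p : Eucl n × ℝ => gradV φ p.1 p.2) (w ρ₀, ρ₀)
  have hslice : HasFDerivAt (fun u => gradV φ u ρ₀)
      (L.comp (ContinuousLinearMap.inl ℝ (Eucl n) ℝ)) (w ρ₀) :=
    hstrict.hasFDerivAt.comp (w ρ₀) (f := fun u : Eucl n => (u, ρ₀))
      (hasFDerivAt_prodMk_left (w ρ₀) ρ₀)
  have hcrit : ∀ ρ, ∀ u ∈ orbit ς (w ρ), gradV φ u ρ = 0 := fun ρ u hu =>
    (hF (Set.mem_iUnion.2 ⟨ρ, hu, rfl⟩ : (u, ρ) ∈ trivialFamily ς w)).2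
  have hle := tangentSpaceOf_le_ker_hessV hslice.differentiableAt (hcrit ρ₀)
  by_contra hlt
  have hker := Submodule.eq_of_le_of_finrank_le hle (not_lt.1 hlt)
  obtain ⟨δ, hδ, hinj⟩ := exists_ball_injOn_of_hasStrictFDerivAt hstrict
    (N := (tangentSpaceOf (orbit ς (w ρ₀)) (w ρ₀))ᗮ) (by
      intro u hu hLu
      have hmem : u ∈ tangentSpaceOf (orbit ς (w ρ₀)) (w ρ₀) := by
        rw [hker, LinearMap.mem_ker]
        change hessV φ (w ρ₀) ρ₀ u = 0
        rw [hessV, hslice.fderiv]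
        exact hLu
      exact inner_self_eq_zero.1 (Submodule.inner_right_of_mem_orthogonal hmem hu))
  refine (accPt_iff_frequently.1 hρ₀) ?_
  -- Continuity of `w` keeps `w ρ`, not only `v`, in the ball where injectivity holds.
  have hnear : ∀ᶠ p : Eucl n × ℝ in nhds (w ρ₀, ρ₀),
      ‖p.1 - w ρ₀‖ < δ ∧ ‖w p.2 - w ρ₀‖ < δ ∧ |p.2 - ρ₀| < δ := by
    have h1 : Continuous fun p : Eucl n × ℝ => ‖p.1 - w ρ₀‖ := by fun_prop
    have h2 : Continuous fun p : Eucl n × ℝ => ‖w p.2 - w ρ₀‖ := by fun_prop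
    have h3 : Continuous fun p : Eucl n × ℝ => |p.2 - ρ₀| := by fun_prop
    exact (h1.continuousAt.eventually_lt_const (by simpa using hδ)).and
      ((h2.continuousAt.eventually_lt_const (by simpa using hδ)).and
        (h3.continuousAt.eventually_lt_const (by simpa using hδ)))
  filter_upwards [hnear] with ⟨v, ρ⟩ ⟨hv, hwρ, hρ⟩
  rintro ⟨-, ⟨hvΩ, hvcrit⟩, hnot⟩
  refine hnot (Set.mem_iUnion.2 ⟨ρ, ?_, rfl⟩)
  obtain ⟨g, hgN, hgle⟩ := exists_act_sub_mem_orthogonal ς hς (w ρ₀) v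
  obtain ⟨h, hhN, hhle⟩ := exists_act_sub_mem_orthogonal ς hς (w ρ₀) (w ρ)
  have heq : act ς g v = act ς h (w ρ) := by
    refine hinj _ _ ρ (hgle.trans_lt hv) (hhle.trans_lt hwρ) hρ ?_ ?_
    · simpa using Submodule.sub_mem _ hgN hhN
    · exact (gradV_act_eq_zero hΩ hΩG hφ hφG hvΩ hvcrit g).trans (hcrit ρ _ ⟨h, rfl⟩).symm
  refine ⟨g⁻¹ * h, ?_⟩
  change act ς (g⁻¹ * h) (w ρ) = v
  rw [act_mul, ← heq, ← act_mul, inv_mul_cancel, act_one]
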